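/- A (discrete-time) Kyle game consists of the following data: a number $T\ge 1$ of trading rounds; a set $I=\{1,\dots,N\}$, $N\ge1$, of information states with true values $v^1\ge v^2\ge\dots\ge v^N$ in $\mathbb R$ and a probability distribution $\nu$ on $I$ with $\nu>0$; partitions $\mathcal I_1,\dots,\mathcal I_T$ of $I$ into nonempty blocks, each block of $\mathcal I_{t}$ ($t\ge2$) being contained in a block of $\mathcal I_{t-1}$, together with $\mathcal I_{T+1}:=\{\{1\},\dots,\{N\}\}$; nonempty finite sets $E_X,E_Z\subseteq\mathbb R$ of possible trades of the insider and of the noise trader; and a probability distribution $\zeta$ on $E_Z$ with $\zeta>0$. For a finite set $A$ let $\Delta A$ denote the set of probability distributions on $A$, and let $E_Y:=\{x+z: x\in E_X, z\in E_Z\}$. All nodes below have $I_s\in\mathcal I_s$, $I_1\supseteq I_2\supseteq\cdots$, $x_s\in E_X$, $z_s\in E_Z$. Let $\mathbb T_V$ be the set of nodes $(I_1,x_1,z_1,\dots,I_t,x_t,z_t)$, $t=0,\dots,T$ (the root for $t=0$), $\mathbb T_X$ the set of nodes $(I_1,x_1,z_1,\dots,x_{t-1},z_{t-1},I_t)$,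 $t=1,\dots,T$, and $\Omega$ the set of terminal nodes $\omega=(I_1,x_1,z_1,\dots,I_T,x_T,z_T,\{i\})$. A behaviour strategy is a map $\xi:\mathbb T_X\to\Delta E_X$; it is completely mixed if $\xi(\tau,\{x\})>0$ for all $\tau\in\mathbb T_X$, $x\in E_X$. A system of beliefs is a family $\mu=(\mu_t)_{t=1,\dots,T}$ of maps $\mu_t:(E_Y)^t\to\Delta I$; it induces the prices $S^\mu_t(y_1,\dots,y_t):=\sum_{i=1}^N\mu_t(i\mid y_1,\dots,y_t)\,v^i$. For $\omega$ as above put $$U(\omega,S):=\sum_{t=1}^T\bigl[v^i-S_t(x_1+z_1,\dots,x_t+z_t)\bigr]x_t ,\qquad p^\xi(\omega):=\nu(\{i\})\prod_{s=1}^T\xi\bigl((I_1,x_1,z_1,\dots,I_s),\{x_s\}\bigr)\,\zeta(\{z_s\}).$$ For $\tau=(I_1,x_1,z_1,\dots,I_t,x_t,z_t)\in\mathbb T_V$ let $$u_\tau(\xi,S):=\sum_{\omega\in\Omega\text{ after }\tau}\ \frac{\nu(\{i\})}{\sum_{j\in I_t}\nu(\{j\})}\prod_{s=t+1}^T\xi\bigl((I_1,x_1,z_1,\dots,I_s),\{x_s\}\bigr)\,\zeta(\{z_s\})\;U(\omega,S),$$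 where $I_0:=I$ in the case of the root. A behaviour strategy $\xi$ is subgame optimal given $S$ if $u_\tau(\xi,S)\ge u_\tau(\xi',S)$ for all $\tau\in\mathbb T_V$ and all behaviour strategies $\xi'$. Let $p^\xi_Y(i,y_1,\dots,y_t)$ be the sum of $p^\xi(\omega)$ over all $\omega\in\Omega$ with terminal state $i$ and $x_s+z_s=y_s$ for $s=1,\dots,t$, and $p^\xi_Y(y_1,\dots,y_t):=\sum_{i=1}^Np^\xi_Y(i,y_1,\dots,y_t)$. Beliefs $\mu$ are rational assuming $\xi$ if $\mu_t(i\mid y_1,\dots,y_t)=p^\xi_Y(i,y_1,\dots,y_t)/p^\xi_Y(y_1,\dots,y_t)$ for all $i\in I$, $t\in\{1,\dots,T\}$ and $(y_1,\dots,y_t)\in(E_Y)^t$ with $p^\xi_Y(y_1,\dots,y_t)>0$. Beliefs $\mu$ are consistent with $\xi$ if there are behaviour strategies $\xi^n$ and beliefs $\mu^n$, $n\in\mathbb N$, such that $(\xi^n,\mu^n)\to(\xi,\mu)$ coordinatewise, every $\xi^n$ is completely mixed, and every $\mu^n$ is rational assuming $\xi^n$. **Theorem.** Every Kyle game has a sequential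 Kyle equilibrium, that is, a pair $(\xi^\star,\mu^\star)$ of a behaviour strategy and a system of beliefs such that $\xi^\star$ is subgame optimal given $S^{\mu^\star}$, and $\mu^\star$ is consistent with $\xi^\star$. -/

import Mathlib

open Filter Topology

noncomputable section

/-- A discrete-time Kyle game.  Trading rounds are indexed by `Fin T` and information states by
`Fin N`; a partition has pairwise disjoint nonempty blocks that cover the set of states. -/
structure KyleGame where
  /-- number of trading rounds -/
  T : ℕ
  T_pos : 0 < T
  /-- number of fundamental information states -/
  N : ℕ
  N_pos : 0 < N
  /-- true value of the asset in each state, in nonincreasing order -/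
  v : Fin N → ℝ
  v_antitone : Antitone v
  /-- the insider's information partition in each round -/
  info : Fin T → Finpartition (Finset.univ : Finset (Fin N))
  /-- the information partitions are refining -/
  info_refining : ∀ s t : Fin T, (s : ℕ) + 1 = (t : ℕ) →
    ∀ A ∈ (info t).parts, ∃ B ∈ (info s).parts, A ⊆ B
  /-- admissible trades of the insider -/
  EX : Finset ℝ
  EX_nonempty : EX.Nonempty
  /-- possible trades of the noise trader -/
  EZ : Finset ℝ
  /-- law of the fundamental information state -/
  ν : stdSimplex ℝ (Fin N)
  ν_pos : ∀ i, 0 < ν i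
  /-- law of the noise trader's demand in each round -/
  ζ : stdSimplex ℝ EZ
  ζ_pos : ∀ z, 0 < ζ z

namespace KyleGame

variable (G : KyleGame)

/-- The information partitions, continued after the last trading round by the partition into
singletons (the true state is then fully revealed). -/
def partition (s : ℕ) : Finpartition (Finset.univ : Finset (Fin G.N)) :=
  if h : s < G.T then G.info ⟨s, h⟩ else ⊥

/-- A history in which information has been revealed `a` times and `b` rounds of trading have taken
place: a decreasing chain of blocks of the successive information partitions, together with
the trades of the insider and of the noise trader. -/
@[ext]
structure Hist (a b : ℕ) where
  I : Fin a → Finset (Fin G.N)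
  I_mem : ∀ s : Fin a, I s ∈ (G.partition s).parts
  I_antitone : Antitone I
  x : Fin b → G.EX
  z : Fin b → G.EZ

instance (a b : ℕ) : Fintype (G.Hist a b) :=
  Fintype.ofInjective
    (fun h : G.Hist a b => ((h.I, h.x, h.z) :
      (Fin a → Finset (Fin G.N)) × (Fin b → G.EX) × (Fin b → G.EZ)))
    (fun h h' e => by
      simp only [Prod.mk.injEq] at e
      exact Hist.ext e.1 e.2.1 e.2.2)

/-- Nodes at which new information is revealed, `(I₁, x₁, z₁, …, I_t, x_t, z_t)` with
`t = 0, …, T`; the case `t = 0` is the root. -/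
abbrev InfoNode : Type := Σ t : Fin (G.T + 1), G.Hist t t

/-- Nodes at which the insider trades, `(I₁, x₁, z₁, …, I_t)`: `t` rounds of trading are
completed, `t = 0, …, T - 1`, and the next piece of information has been revealed. -/
abbrev InsiderNode : Type := Σ t : Fin G.T, G.Hist (t + 1) t

/-- Terminal nodes `(I₁, x₁, z₁, …, I_T, x_T, z_T, {i})`. -/
abbrev Outcome : Type := G.Hist (G.T + 1) G.T

variable {G}

/-- The initial segment of a history. -/
def Hist.trunc {a b : ℕ} (h : G.Hist a b) (a' b' : ℕ) (ha : a' ≤ a) (hb : b' ≤ b) :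
    G.Hist a' b' where
  I s := h.I (Fin.castLE ha s)
  I_mem s := h.I_mem (Fin.castLE ha s)
  I_antitone _ _ hst := h.I_antitone hst
  x s := h.x (Fin.castLE hb s)
  z s := h.z (Fin.castLE hb s)

theorem Outcome.exists_state (ω : G.Outcome) : ∃ i : Fin G.N, ω.I (Fin.last G.T) = {i} := by
  have h := ω.I_mem (Fin.last G.T)
  rw [partition, dif_neg (by simp), Finpartition.mem_bot_iff] at h
  obtain ⟨i, -, hi⟩ := h
  exact ⟨i, hi.symm⟩

/-- The state `i` that is revealed at the terminal node `(I₁, x₁, z₁, …, {i})`. -/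
def Outcome.state (ω : G.Outcome) : Fin G.N := ω.exists_state.choose

/-- The insider's node in round `s` on the path to the terminal node `ω`. -/
def Outcome.insiderNode (ω : G.Outcome) (s : Fin G.T) : G.InsiderNode :=
  ⟨s, Hist.trunc ω (s + 1) s (by omega) (by omega)⟩

/-- The terminal node `ω` comes after the node `τ`. -/
def Outcome.After (ω : G.Outcome) (τ : G.InfoNode) : Prop :=
  Hist.trunc ω τ.1 τ.1 (by omega) (by omega) = τ.2

/-- The set of states that are attainable at a node at which new information is about to be
revealed: the last revealed block, or all states at the root. -/
def InfoNode.attainable (τ : G.InfoNode) : Finset (Fin G.N) :=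
  if h : 0 < (τ.1 : ℕ) then τ.2.I ⟨τ.1 - 1, by omega⟩ else Finset.univ

variable (G)

/-- Behaviour strategies of the insider. -/
abbrev BehaviourStrategy : Type := G.InsiderNode → stdSimplex ℝ G.EX

variable {G}

/-- Realisation probability of a terminal node. -/
def prob (ξ : G.BehaviourStrategy) (ω : G.Outcome) : ℝ :=
  G.ν ω.state *
    ∏ s : Fin G.T, ξ (ω.insiderNode s) (ω.x s) * G.ζ (ω.z s)

/-- Realisation probability of a terminal node `ω` after `τ`, conditional on starting in `τ`. -/
def subgameProb (ξ : G.BehaviourStrategy) (τ : G.InfoNode) (ω : G.Outcome) : ℝ :=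
  G.ν ω.state / (∑ j ∈ τ.attainable, G.ν j) *
    ∏ s ∈ Finset.univ.filter (fun s : Fin G.T => (τ.1 : ℕ) ≤ (s : ℕ)),
      ξ (ω.insiderNode s) (ω.x s) * G.ζ (ω.z s)

variable (G)

/-- Possible values of the total order flow in one round. -/
def EY : Finset ℝ := Finset.image₂ (fun x z => x + z) G.EX G.EZ

/-- Sequences of total order flows observed by the market maker up to and including round `t`. -/
abbrev OrderFlow (t : Fin G.T) : Type := Fin (t + 1) → G.EY

/-- The highest possible value of the asset. -/
def vMax : ℝ := G.v ⟨0, G.N_pos⟩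

/-- The lowest possible value of the asset. -/
def vMin : ℝ := G.v ⟨G.N - 1, Nat.sub_lt G.N_pos one_pos⟩

/-- Pricing systems of the market maker. -/
abbrev PricingSystem : Type := (t : Fin G.T) → G.OrderFlow t → Set.Icc G.vMin G.vMax

/-- Systems of beliefs of the market maker. -/
abbrev Beliefs : Type := (t : Fin G.T) → G.OrderFlow t → stdSimplex ℝ (Fin G.N)

variable {G}

/-- The total order flow up to and including round `t` on the path to the terminal node `ω`. -/
def Outcome.orderFlow (ω : G.Outcome) (t : Fin G.T) : G.OrderFlow t := fun s =>
  ⟨(ω.x (Fin.castLE t.isLt s) : ℝ) + (ω.z (Fin.castLE t.isLt s) : ℝ),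
    Finset.mem_image₂_of_mem (ω.x _).2 (ω.z _).2⟩

/-- The insider's payoff at a terminal node. -/
def payoff (ω : G.Outcome) (S : G.PricingSystem) : ℝ :=
  ∑ t : Fin G.T, (G.v ω.state - (S t (ω.orderFlow t) : ℝ)) * (ω.x t : ℝ)

open Classical in
/-- The insider's expected utility in the subgame starting in `τ`. -/
def subgameUtility (ξ : G.BehaviourStrategy) (S : G.PricingSystem) (τ : G.InfoNode) : ℝ :=
  ∑ ω : G.Outcome with ω.After τ, subgameProb ξ τ ω * payoff ω S

/-- Subgame optimality of a behaviour strategy. -/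
def IsSubgameOptimal (ξ : G.BehaviourStrategy) (S : G.PricingSystem) : Prop :=
  ∀ (τ : G.InfoNode) (ξ' : G.BehaviourStrategy), subgameUtility ξ' S τ ≤ subgameUtility ξ S τ

/-- Joint probability of the state `i` and the total order flow `y`, if the insider plays `ξ`. -/
def jointProb (ξ : G.BehaviourStrategy) {t : Fin G.T} (i : Fin G.N) (y : G.OrderFlow t) : ℝ :=
  ∑ ω : G.Outcome with ω.state = i ∧ ω.orderFlow t = y, prob ξ ω

/-- Probability of the total order flow `y`, if the insider plays `ξ`. -/
def flowProb (ξ : G.BehaviourStrategy) {t : Fin G.T} (y : G.OrderFlow t) : ℝ :=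
  ∑ i : Fin G.N, jointProb ξ i y

/-- Rational beliefs: Bayes' rule holds at all order flows of positive probability. -/
def IsRational (μ : G.Beliefs) (ξ : G.BehaviourStrategy) : Prop :=
  ∀ (t : Fin G.T) (y : G.OrderFlow t), 0 < flowProb ξ y →
    ∀ i : Fin G.N, μ t y i = jointProb ξ i y / flowProb ξ y

/-- Completely mixed behaviour strategies. -/
def IsCompletelyMixed (ξ : G.BehaviourStrategy) : Prop :=
  ∀ (τ : G.InsiderNode) (x : G.EX), 0 < ξ τ x

/-- Consistent beliefs.  Convergence is convergence of all (finitely many) coordinates. -/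
def IsConsistent (μ : G.Beliefs) (ξ : G.BehaviourStrategy) : Prop :=
  ∃ (ξs : ℕ → G.BehaviourStrategy) (μs : ℕ → G.Beliefs),
    (∀ (τ : G.InsiderNode) (x : G.EX),
      Tendsto (fun n => ξs n τ x) atTop (𝓝 (ξ τ x))) ∧
    (∀ (t : Fin G.T) (y : G.OrderFlow t) (i : Fin G.N),
      Tendsto (fun n => μs n t y i) atTop (𝓝 (μ t y i))) ∧
    (∀ n, IsCompletelyMixed (ξs n)) ∧
    (∀ n, IsRational (μs n) (ξs n))

theorem v_mem_Icc (i : Fin G.N) : G.v i ∈ Set.Icc G.vMin G.vMax :=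
  ⟨G.v_antitone (Fin.le_def.mpr (Nat.le_sub_one_of_lt i.isLt)),
    G.v_antitone (Fin.le_def.mpr (Nat.zero_le _))⟩

/-- The pricing system induced by a system of beliefs. -/
def pricing (μ : G.Beliefs) : G.PricingSystem := fun t y =>
  ⟨∑ i : Fin G.N, μ t y i * G.v i,
    (convex_Icc G.vMin G.vMax).sum_mem (fun i _ => (μ t y).2.1 i) (μ t y).2.2
      (fun i _ => v_mem_Icc i)⟩

/-- Sequential Kyle equilibria. -/
def IsSequentialKyleEquilibrium (ξ : G.BehaviourStrategy) (μ : G.Beliefs) : Prop :=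
  IsSubgameOptimal ξ (pricing μ) ∧ IsConsistent μ ξ

end KyleGame

end

/-! The proof perturbs the game and lets the perturbation vanish. Let the insider tremble uniformly
with probability `ε`. Every order flow then has positive probability, so Bayes' rule determines the
beliefs and makes them, and hence prices, continuous in the strategy (`continuous_bayesBeliefs`).
Treat each insider node as a separate player who takes as given the prices and the trembling play at
later nodes. The value of a trade at a node depends continuously, though not multilinearly, on the
whole strategy. Nash's fixed-point map needs no more than that, so there is a strategy that uses
only optimal trades at every node, reached or not (`exists_mixed_equilibrium`).

Strategies and beliefs form a compact space. Along a subsequence with `ε → 0` both converge;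
consistency holds by construction, and nodewise optimality survives because trades with positive
limit weight are eventually in use. The one-shot deviation principle (`continuationValue_le`) turns
nodewise optimality into subgame optimality.

Brouwer's theorem is derived from Scarf's combinatorial lemma (`exists_dominant_image_eq_univ`),
applied to fine grids on the simplex. -/

open Filter Topology

noncomputable section

/-! ### Scarf's lemma on dominant sets -/

section Scarf

variable {I X : Type*}

/-- A finite set of points is dominant for a family of rankings if every point is ranked, by at
least one of them, no higher than all members of the set. -/
def IsDominant (r : I → X → ℤ) (σ : Finset X) : Prop :=
  ∀ y, ∃ i, ∀ x ∈ σ, r i y ≤ r i x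

theorem IsDominant.mono {r : I → X → ℤ} {σ τ : Finset X} (h : IsDominant r σ) (hτ : τ ⊆ σ) :
    IsDominant r τ := fun y => (h y).imp fun _ hi x hx => hi x (hτ hx)

/-- The points ranked strictly higher than `m i` by every ranking `i ≠ j`. -/
def aboveExcept (r : I → X → ℤ) (m : I → X) (j : I) : Set X :=
  {y | ∀ i, i ≠ j → r i (m i) < r i y}

variable [Fintype I] [DecidableEq I] [Fintype X] [DecidableEq X]

open Classical in
/-- The points that extend a dominant set with one element less than there are rankings to a
dominant set. -/
theorem card_dominant_insert {r : I → X → ℤ} (hr : ∀ i, Function.Injective (r i))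
    {τ : Finset X} (hτ : IsDominant r τ) (hcard : τ.card + 1 = Fintype.card I)
    (hne : τ.Nonempty) :
    ∃ (m : I → X) (i₁ i₂ : I), i₁ ≠ i₂ ∧ m i₁ = m i₂ ∧ (∀ i, m i ∈ τ) ∧
      (∀ i, ∀ x ∈ τ, r i (m i) ≤ r i x) ∧
      (Finset.univ.filter fun x => x ∉ τ ∧ IsDominant r (insert x τ)).card =
        (if (aboveExcept r m i₁).Nonempty then 1 else 0) +
          (if (aboveExcept r m i₂).Nonempty then 1 else 0) := by
  choose m hm hmin using fun i => Finset.exists_min_image τ (r i) hne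
  have hmeq : ∀ i, ∀ x ∈ τ, r i x ≤ r i (m i) → m i = x := fun i x hx h =>
    hr i (le_antisymm (hmin i x hx) h)
  -- Dominance tested at a member of `τ` says that this member is lowest for some ranking. There is
  -- one more ranking than there are points, so exactly one pair of rankings shares its lowest
  -- point.
  have hsurj : ∀ x ∈ τ, ∃ i, m i = x := fun x hx => by
    obtain ⟨i, hi⟩ := hτ x
    exact ⟨i, hmeq i x hx (hi _ (hm i))⟩
  obtain ⟨i₁, -, i₂, -, h12, he⟩ : ∃ i₁ ∈ (Finset.univ : Finset I), ∃ i₂ ∈ (Finset.univ : Finset I),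
      i₁ ≠ i₂ ∧ m i₁ = m i₂ :=
    Finset.exists_ne_map_eq_of_card_lt_of_maps_to (t := τ)
      (by rw [Finset.card_univ]; omega) (fun i _ => hm i)
  -- after removing one of the two indices with the same minimum, `m` is a bijection
  have hsurj' : ∀ j k, j ≠ k → m j = m k → ∀ x ∈ τ, ∃ i, i ≠ j ∧ m i = x := by
    intro j k hjk hm' x hx
    obtain ⟨i, rfl⟩ := hsurj x hx
    by_cases hij : i = j
    · exact ⟨k, hjk.symm, by rw [hij, hm']⟩
    · exact ⟨i, hij, rfl⟩
  have hinj : ∀ j k, j ≠ k → m j = m k → ∀ i i', i ≠ j → i' ≠ j → m i = m i' → i = i' := by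
    intro j k hjk hm' i i' hi hi' hii
    have himg : (Finset.univ.erase j).image m = τ := by
      apply Finset.Subset.antisymm
      · intro x hx
        obtain ⟨i, -, rfl⟩ := Finset.mem_image.1 hx
        exact hm i
      · intro x hx
        obtain ⟨i, hi, rfl⟩ := hsurj' j k hjk hm' x hx
        exact Finset.mem_image_of_mem _ (by simp [hi])
    have hc : ((Finset.univ.erase j).image m).card = (Finset.univ.erase j).card := by
      rw [himg, Finset.card_erase_of_mem (Finset.mem_univ j), Finset.card_univ]; omega
    exact Finset.card_image_iff.1 hc (by simp [hi]) (by simp [hi']) hii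
  have htwin : ∀ i j, i ≠ j → m i = m j → j = i₁ ∨ j = i₂ := by
    intro i j hij hm'
    by_contra! hcon
    by_cases hi : i = i₁
    · exact hcon.2 (hinj i₁ i₂ h12 he j i₂ hcon.1 h12.symm (by rw [← hm', hi, he]))
    · exact hij (hinj i₁ i₂ h12 he i j hi hcon.1 hm')
  have hpair : ∀ j, j = i₁ ∨ j = i₂ → ∃ k, j ≠ k ∧ m j = m k := by
    rintro j (rfl | rfl)
    · exact ⟨i₂, h12, he⟩
    · exact ⟨i₁, h12.symm, he.symm⟩
  have hnot : ∀ j, j = i₁ ∨ j = i₂ → ∀ x ∈ aboveExcept r m j, x ∉ τ := by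
    intro j hj x hx hxτ
    obtain ⟨k, hjk, hm'⟩ := hpair j hj
    obtain ⟨i, hi, rfl⟩ := hsurj' j k hjk hm' x hxτ
    exact lt_irrefl _ (hx i hi)
  have hdisj : ∀ x, x ∈ aboveExcept r m i₁ → x ∈ aboveExcept r m i₂ → False := by
    intro x h1 h2
    obtain ⟨i, hi⟩ := hτ x
    by_cases hi1 : i = i₁
    · exact absurd (hi _ (hm i)) (not_le.2 (h2 i (by rw [hi1]; exact h12)))
    · exact absurd (hi _ (hm i)) (not_le.2 (h1 i hi1))
  -- An extending point must replace the lowest point of one of the twin rankings `j`, and dominance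
  -- forces it to be the `j`-highest point of `aboveExcept r m j`. So each twin contributes at most
  -- one extension.
  let A : I → Finset X := fun j =>
    Finset.univ.filter fun x => x ∈ aboveExcept r m j ∧ ∀ y ∈ aboveExcept r m j, r j y ≤ r j x
  have hA : ∀ j, (A j).card = if (aboveExcept r m j).Nonempty then 1 else 0 := by
    intro j
    split_ifs with h
    · obtain ⟨x, hx, hmax⟩ := (Set.toFinite (aboveExcept r m j)).exists_maximalFor (r j) _ h
      have hmax' : ∀ y ∈ aboveExcept r m j, r j y ≤ r j x := fun y hy =>
        (le_total (r j y) (r j x)).elim id (hmax hy)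
      refine Finset.card_eq_one.2 ⟨x, ?_⟩
      ext y
      simp only [A, Finset.mem_filter, Finset.mem_univ, true_and, Finset.mem_singleton]
      constructor
      · rintro ⟨hy, hy'⟩
        exact hr j (le_antisymm (hmax' y hy) (hy' x hx))
      · rintro rfl
        exact ⟨hx, hmax'⟩
    · rw [Finset.card_eq_zero]
      ext y
      simp only [A, Finset.mem_filter, Finset.mem_univ, true_and, Finset.notMem_empty, iff_false]
      exact fun hy => h ⟨y, hy.1⟩
  refine ⟨m, i₁, i₂, h12, he, hm, hmin, ?_⟩
  rw [← hA, ← hA, ← Finset.card_union_of_disjoint]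
  swap
  · rw [Finset.disjoint_left]
    intro x h1 h2
    simp only [A, Finset.mem_filter, Finset.mem_univ, true_and] at h1 h2
    exact hdisj x h1.1 h2.1
  congr 1
  ext x
  simp only [A, Finset.mem_filter, Finset.mem_univ, true_and, Finset.mem_union]
  constructor
  · rintro ⟨hx, hdom⟩
    have hlt : ∀ i, ∀ w ∈ τ, r i w ≤ r i x → r i w < r i x := fun i w hw h =>
      lt_of_le_of_ne h fun h' => hx (by rw [← hr i h']; exact hw)
    obtain ⟨j, hj⟩ := hdom x
    -- Since `x` is lowest for `j`, every point of `τ` must stay lowest for a ranking other than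
    -- `j`. Hence `m j` is also the lowest point of another ranking, and `j` is a twin.
    have hcov : ∀ w ∈ τ, ∃ i, i ≠ j ∧ m i = w ∧ r i (m i) < r i x := by
      intro w hw
      obtain ⟨i, hi⟩ := hdom w
      have h1 : m i = w := hmeq i w hw (hi _ (Finset.mem_insert_of_mem (hm i)))
      have h2 : r i w < r i x := hlt i w hw (hi x (Finset.mem_insert_self _ _))
      refine ⟨i, ?_, h1, by rw [h1]; exact h2⟩
      rintro rfl
      exact absurd (hj w (Finset.mem_insert_of_mem hw)) (not_le.2 h2)
    have hj12 : j = i₁ ∨ j = i₂ := by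
      obtain ⟨i, hij, hi, -⟩ := hcov (m j) (hm j)
      exact htwin i j hij hi
    obtain ⟨k, hjk, hm'⟩ := hpair j hj12
    have hxM : x ∈ aboveExcept r m j := by
      intro i hi
      obtain ⟨i', hi', he', hlt'⟩ := hcov (m i) (hm i)
      rwa [hinj j k hjk hm' i' i hi' hi he'] at hlt'
    have hxmax : ∀ y ∈ aboveExcept r m j, r j y ≤ r j x := by
      intro y hy
      obtain ⟨i, hi⟩ := hdom y
      by_cases hij : i = j
      · rw [← hij]; exact hi x (Finset.mem_insert_self _ _)
      · exact absurd (hi _ (Finset.mem_insert_of_mem (hm i))) (not_le.2 (hy i hij))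
    rcases hj12 with rfl | rfl
    · exact Or.inl ⟨hxM, hxmax⟩
    · exact Or.inr ⟨hxM, hxmax⟩
  · intro h
    obtain ⟨j, hj, hxM, hxmax⟩ : ∃ j, (j = i₁ ∨ j = i₂) ∧ x ∈ aboveExcept r m j ∧
        ∀ y ∈ aboveExcept r m j, r j y ≤ r j x := by
      rcases h with h | h
      · exact ⟨i₁, Or.inl rfl, h⟩
      · exact ⟨i₂, Or.inr rfl, h⟩
    refine ⟨hnot j hj x hxM, fun y => ?_⟩
    by_cases hy : y ∈ aboveExcept r m j
    · refine ⟨j, fun z hz => ?_⟩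
      rcases Finset.mem_insert.1 hz with rfl | hz
      · exact hxmax y hy
      · obtain ⟨i, hi⟩ := hτ x
        have hij : i = j := by
          by_contra hij
          exact absurd (hi _ (hm i)) (not_le.2 (hxM i hij))
        subst hij
        exact (hxmax y hy).trans (hi z hz)
    · simp only [aboveExcept, Set.mem_ofPred_eq, not_forall, not_lt] at hy
      obtain ⟨i, hij, hi⟩ := hy
      refine ⟨i, fun z hz => ?_⟩
      rcases Finset.mem_insert.1 hz with rfl | hz
      · exact hi.trans (hxM i hij).le
      · exact hi.trans (hmin i z hz)

-- The count is 0 or 2. If removing `x` leaves each colour but `i₀` exactly once, then `c x ≠ i₀`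
-- because `σ` misses a colour. So the colour of `x` occurs at exactly one other point, and that
-- point is the only other one that can be removed.
omit [Fintype X] in
theorem even_card_erase_image {c : X → I} {i₀ : I} {σ : Finset X}
    (hcard : σ.card = Fintype.card I) (hc : σ.image c ≠ Finset.univ) :
    Even (σ.filter fun x => (σ.erase x).image c = Finset.univ.erase i₀).card := by
  rcases Finset.eq_empty_or_nonempty
    (σ.filter fun x => (σ.erase x).image c = Finset.univ.erase i₀) with h | ⟨x, hx⟩
  · simp [h]
  obtain ⟨hxσ, himg⟩ := Finset.mem_filter.1 hx
  have hinj : Set.InjOn c (σ.erase x : Finset X) := by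
    rw [← Finset.card_image_iff, himg, Finset.card_erase_of_mem hxσ,
      Finset.card_erase_of_mem (Finset.mem_univ _), Finset.card_univ, hcard]
  have hmem : ∀ w ∈ σ, w ≠ x → c w ≠ i₀ := fun w hw hwx => by
    have : c w ∈ (σ.erase x).image c := Finset.mem_image_of_mem _ (Finset.mem_erase.2 ⟨hwx, hw⟩)
    rw [himg] at this
    exact Finset.ne_of_mem_erase this
  have hpre : ∀ i, i ≠ i₀ → ∃ w ∈ σ, w ≠ x ∧ c w = i := fun i hi => by
    have : i ∈ (σ.erase x).image c := by rw [himg]; simp [hi]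
    obtain ⟨w, hw, rfl⟩ := Finset.mem_image.1 this
    exact ⟨w, Finset.mem_of_mem_erase hw, Finset.ne_of_mem_erase hw, rfl⟩
  have hx0 : c x ≠ i₀ := by
    intro h0
    apply hc
    rw [Finset.eq_univ_iff_forall]
    intro i
    by_cases hi : i = i₀
    · rw [hi, ← h0]; exact Finset.mem_image_of_mem _ hxσ
    · obtain ⟨w, hw, -, rfl⟩ := hpre i hi
      exact Finset.mem_image_of_mem _ hw
  obtain ⟨x', hx'σ, hx'x, hcx'⟩ := hpre (c x) hx0
  have hS : (σ.filter fun x => (σ.erase x).image c = Finset.univ.erase i₀) = {x, x'} := by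
    ext y
    simp only [Finset.mem_filter, Finset.mem_insert, Finset.mem_singleton]
    constructor
    · rintro ⟨hyσ, hy⟩
      by_contra! hne
      have : c y ∈ (σ.erase y).image c := by
        rw [hy]; simp [hmem y hyσ hne.1]
      obtain ⟨w, hw, hwy⟩ := Finset.mem_image.1 this
      have hwσ := Finset.mem_of_mem_erase hw
      have hwx : w = x := by
        by_contra hwx
        exact Finset.ne_of_mem_erase hw
          (hinj (by simp [hwx, hwσ]) (by simp [hne.1, hyσ]) hwy)
      subst hwx
      exact hne.2 (hinj (by simp [hne.1, hyσ]) (by simp [hx'x, hx'σ]) (by rw [← hwy, hcx']))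
    · rintro (rfl | rfl)
      · exact ⟨hxσ, himg⟩
      · refine ⟨hx'σ, ?_⟩
        ext i
        simp only [Finset.mem_image, Finset.mem_erase, Finset.mem_univ, and_true]
        constructor
        · rintro ⟨w, ⟨-, hw⟩, rfl⟩
          by_cases hwx : w = x
          · rw [hwx]; exact hx0
          · exact hmem w hw hwx
        · intro hi
          obtain ⟨w, hw, hwx, rfl⟩ := hpre i hi
          by_cases hwx' : w = y
          · exact ⟨x, ⟨hx'x.symm, hxσ⟩, by rw [hwx', hcx']⟩
          · exact ⟨w, ⟨hwx', hw⟩, rfl⟩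
  rw [hS, Finset.card_pair hx'x.symm]
  exact even_two

omit [Fintype X] in
theorem exists_insert_eq_of_subset {σ τ : Finset X} (h : τ ⊆ σ) (hcard : τ.card + 1 = σ.card) :
    ∃ x ∉ τ, insert x τ = σ := by
  rw [← Finset.covBy_iff_exists_insert, Finset.covBy_iff_card_sdiff_eq_one]
  refine ⟨h, ?_⟩
  rw [Finset.card_sdiff_of_subset h]
  omega

set_option maxHeartbeats 1000000 in
/-- Scarf's lemma.  The points `s i` are the artificial points at the boundary: `s i` is ranked
lowest by ranking `i`, and above all ordinary points by all other rankings. -/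
theorem exists_dominant_image_eq_univ [Nonempty I] {r : I → X → ℤ}
    (hr : ∀ i, Function.Injective (r i)) {s : I → X}
    (hlow : ∀ i y, y ≠ s i → r i (s i) < r i y)
    (hhigh : ∀ i j y, j ≠ i → y ∉ Set.range s → r i y < r i (s j))
    (hord : ∃ y, y ∉ Set.range s) {c : X → I} (hcs : ∀ i, c (s i) = i) :
    ∃ σ : Finset X, IsDominant r σ ∧ σ.card = Fintype.card I ∧ σ.image c = Finset.univ := by
  classical
  obtain ⟨i₀⟩ := ‹Nonempty I›
  obtain ⟨y₀, hy₀⟩ := hord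
  have hsinj : Function.Injective s := fun i j h => by rw [← hcs i, ← hcs j, h]
  -- With a single ranking the sets counted below would be empty, and `card_dominant_insert` needs a
  -- nonempty set.
  by_cases hone : Fintype.card I = 1
  · obtain ⟨x, -, hx⟩ := Finset.exists_max_image Finset.univ (r i₀) ⟨y₀, Finset.mem_univ _⟩
    have hsub : Subsingleton I := Fintype.card_le_one_iff_subsingleton.1 hone.le
    exact ⟨{x}, fun y => ⟨i₀, by simpa using hx y (Finset.mem_univ _)⟩, by simp [hone],
      Finset.eq_univ_iff_forall.2 fun i => by simp [Subsingleton.elim i (c x)]⟩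
  -- Inclusions between `D` and `R` are counted twice. Without a fully coloured set, each member of
  -- `R` contains an even number of members of `D`. Each member of `D` lies in exactly two members
  -- of `R`, except `τ₀`, which lies in exactly one.
  by_contra! hcon
  let R : Finset (Finset X) :=
    Finset.univ.filter fun σ => IsDominant r σ ∧ σ.card = Fintype.card I
  let D : Finset (Finset X) :=
    Finset.univ.filter fun τ => IsDominant r τ ∧ τ.card + 1 = Fintype.card I ∧
      τ.image c = Finset.univ.erase i₀
  have hcount : ∑ σ ∈ R, (D.bipartiteBelow (· ⊆ ·) σ).card =
      ∑ τ ∈ D, (R.bipartiteAbove (· ⊆ ·) τ).card :=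
    (Finset.sum_card_bipartiteAbove_eq_sum_card_bipartiteBelow (s := D) (t := R) (· ⊆ ·)).symm
  have heven : Even (∑ σ ∈ R, (D.bipartiteBelow (· ⊆ ·) σ).card) := by
    refine Finset.even_sum _ fun σ hσ => ?_
    simp only [R, Finset.mem_filter, Finset.mem_univ, true_and] at hσ
    have heq : (σ.filter fun x => (σ.erase x).image c = Finset.univ.erase i₀).card =
        (D.bipartiteBelow (· ⊆ ·) σ).card := ?_
    · exact heq ▸ even_card_erase_image (i₀ := i₀) hσ.2 (hcon σ hσ.1 hσ.2)
    refine Finset.card_bij (fun x _ => σ.erase x) ?_ ?_ ?_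
    · intro x hx
      obtain ⟨hxσ, hx⟩ := Finset.mem_filter.1 hx
      simp only [Finset.mem_bipartiteBelow, D, Finset.mem_filter, Finset.mem_univ, true_and]
      exact ⟨⟨hσ.1.mono (Finset.erase_subset _ _), by
        rw [Finset.card_erase_add_one hxσ, hσ.2], hx⟩, Finset.erase_subset _ _⟩
    · intro x hx y hy hxy
      exact Finset.erase_injOn σ (Finset.mem_filter.1 hx).1 (Finset.mem_filter.1 hy).1 hxy
    · intro τ hτ
      simp only [Finset.mem_bipartiteBelow, D, Finset.mem_filter, Finset.mem_univ, true_and] at hτ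
      obtain ⟨⟨hτd, hτc, hτi⟩, hτσ⟩ := hτ
      obtain ⟨x, hx, rfl⟩ : ∃ x ∉ τ, insert x τ = σ := exists_insert_eq_of_subset hτσ (by omega)
      exact ⟨x, by simp [hx, hτi], by simp [hx]⟩
  let τ₀ : Finset X := (Finset.univ.erase i₀).image s
  have hτ₀card : τ₀.card + 1 = Fintype.card I := by
    rw [Finset.card_image_of_injective _ hsinj, Finset.card_erase_add_one (Finset.mem_univ _),
      Finset.card_univ]
  have hτ₀ : τ₀ ∈ D := by
    simp only [D, Finset.mem_filter, Finset.mem_univ, true_and]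
    refine ⟨?_, hτ₀card, ?_⟩
    · intro y
      by_cases hy : y ∈ Set.range s
      · obtain ⟨i, rfl⟩ := hy
        refine ⟨i, fun x _ => ?_⟩
        by_cases hx : x = s i
        · rw [hx]
        · exact (hlow i x hx).le
      · refine ⟨i₀, fun x hx => ?_⟩
        obtain ⟨j, hj, rfl⟩ := Finset.mem_image.1 hx
        exact (hhigh i₀ j y (Finset.ne_of_mem_erase hj) hy).le
    · ext i
      simp [τ₀, Finset.mem_image, hcs]
  have habove : ∀ τ ∈ D, (R.bipartiteAbove (· ⊆ ·) τ).card =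
      (Finset.univ.filter fun x => x ∉ τ ∧ IsDominant r (insert x τ)).card := by
    intro τ hτ
    simp only [D, Finset.mem_filter, Finset.mem_univ, true_and] at hτ
    symm
    refine Finset.card_bij (fun x _ => insert x τ) ?_ ?_ ?_
    · intro x hx
      simp only [Finset.mem_filter, Finset.mem_univ, true_and] at hx
      simp only [Finset.mem_bipartiteAbove, R, Finset.mem_filter, Finset.mem_univ, true_and]
      exact ⟨⟨hx.2, by rw [Finset.card_insert_of_notMem hx.1, hτ.2.1]⟩, Finset.subset_insert _ _⟩
    · intro x hx y hy hxy
      simp only [Finset.mem_filter, Finset.mem_univ, true_and] at hx hy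
      exact (Finset.insert_inj hx.1).1 hxy
    · intro σ hσ
      simp only [Finset.mem_bipartiteAbove, R, Finset.mem_filter, Finset.mem_univ, true_and] at hσ
      obtain ⟨⟨hσd, hσc⟩, hτσ⟩ := hσ
      obtain ⟨x, hx, rfl⟩ : ∃ x ∉ τ, insert x τ = σ := exists_insert_eq_of_subset hτσ (by omega)
      exact ⟨x, by simp [hx, hσd], rfl⟩
  have hpos : 0 < Fintype.card I := Fintype.card_pos_iff.2 ⟨i₀⟩
  have hnonempty : ∀ τ ∈ D, τ.Nonempty := by
    intro τ hτ
    simp only [D, Finset.mem_filter, Finset.mem_univ, true_and] at hτ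
    rw [← Finset.card_pos]; omega
  have hother : ∀ τ ∈ D.erase τ₀, Even (R.bipartiteAbove (· ⊆ ·) τ).card := by
    intro τ hτ
    obtain ⟨hne, hτ⟩ := Finset.mem_erase.1 hτ
    rw [habove τ hτ]
    have hnon := hnonempty τ hτ
    simp only [D, Finset.mem_filter, Finset.mem_univ, true_and] at hτ
    obtain ⟨m, i₁, i₂, h12, he, hm, hmin, hcard⟩ := card_dominant_insert hr hτ.1 hτ.2.1 hnon
    -- The artificial point `s j` is the witness. If it failed for a ranking `i`, then the
    -- `i`-lowest point of `τ` would be artificial but not `s i`. All of `τ` would then be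
    -- artificial, and the colours would give `τ = τ₀`.
    have hM : ∀ j, (aboveExcept r m j).Nonempty := by
      intro j
      refine ⟨s j, fun i hij => ?_⟩
      by_contra! hle
      have hmr : m i ∈ Set.range s := by
        by_contra hmr
        exact absurd hle (not_le.2 (hhigh i j _ hij.symm hmr))
      have hsi : s i ∉ τ := by
        intro hsi
        have hmi : m i = s i := by
          by_contra hmi
          exact absurd (hmin i _ hsi) (not_le.2 (hlow i _ hmi))
        rw [hmi] at hle
        exact absurd hle (not_le.2 (hlow i _ fun h => hij (hsinj h).symm))
      obtain ⟨k, hk⟩ := hmr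
      have hki : k ≠ i := by
        rintro rfl
        exact hsi (by rw [hk]; exact hm _)
      have hsub : τ ⊆ (Finset.univ.erase i).image s := by
        intro x hx
        by_cases hxr : x ∈ Set.range s
        · obtain ⟨l, rfl⟩ := hxr
          refine Finset.mem_image_of_mem _ (Finset.mem_erase.2 ⟨?_, Finset.mem_univ _⟩)
          rintro rfl
          exact hsi hx
        · have := hmin i x hx
          rw [← hk] at this
          exact absurd this (not_le.2 (hhigh i k x hki hxr))
      have heq : τ = (Finset.univ.erase i).image s := by
        refine Finset.eq_of_subset_of_card_le hsub ?_
        rw [Finset.card_image_of_injective _ hsinj, Finset.card_erase_of_mem (Finset.mem_univ _),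
          Finset.card_univ]
        omega
      have hi0 : i = i₀ := by
        have h2 := hτ.2.2
        rw [heq, Finset.image_image] at h2
        have : c ∘ s = id := funext hcs
        rw [this, Finset.image_id] at h2
        by_contra hi0
        have : i ∈ Finset.univ.erase i₀ := by simp [hi0]
        rw [← h2] at this
        simp at this
      exact hne (by rw [heq, hi0])
    rw [hcard, if_pos (hM _), if_pos (hM _)]
    exact even_two
  have hτ₀odd : Odd (R.bipartiteAbove (· ⊆ ·) τ₀).card := by
    rw [habove τ₀ hτ₀]
    have hnon := hnonempty τ₀ hτ₀
    simp only [D, Finset.mem_filter, Finset.mem_univ, true_and] at hτ₀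
    obtain ⟨m, i₁, i₂, h12, he, hm, hmin, hcard⟩ := card_dominant_insert hr hτ₀.1 hτ₀.2.1 hnon
    have hmi : ∀ i, i ≠ i₀ → m i = s i := by
      intro i hi
      by_contra hmi
      exact absurd (hmin i (s i) (Finset.mem_image_of_mem _ (by simp [hi])))
        (not_le.2 (hlow i _ hmi))
    have hM0 : (aboveExcept r m i₀).Nonempty := by
      refine ⟨y₀, fun i hi => ?_⟩
      rw [hmi i hi]
      exact hlow i _ fun h => hy₀ ⟨i, h.symm⟩
    -- Only an artificial point `s l` with `l ≠ i₀` can exceed `s k` in ranking `i₀`. For `l ≠ k` it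
    -- would have to exceed itself in ranking `l`.
    have hMk : ∀ k, k ≠ i₀ → m i₀ = m k → ¬ (aboveExcept r m k).Nonempty := by
      rintro k hk hmk ⟨y, hy⟩
      have h0 := hy i₀ hk.symm
      rw [hmk, hmi k hk] at h0
      by_cases hyr : y ∈ Set.range s
      · obtain ⟨l, rfl⟩ := hyr
        have hlk : l ≠ k := by
          rintro rfl
          exact lt_irrefl _ h0
        have hl0 : l ≠ i₀ := by
          rintro rfl
          exact absurd h0 (not_lt.2 (hlow l _ fun h => hlk (hsinj h).symm).le)
        have := hy l hlk
        rw [hmi l hl0] at this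
        exact lt_irrefl _ this
      · exact absurd h0 (not_lt.2 (hhigh i₀ k y hk hyr).le)
    rw [hcard]
    by_cases h1 : i₁ = i₀
    · subst h1
      rw [if_pos hM0, if_neg (hMk i₂ h12.symm he)]
      exact odd_one
    · have h2 : i₂ = i₀ := by
        by_contra h2
        rw [hmi _ h1, hmi _ h2] at he
        exact h12 (hsinj he)
      subst h2
      rw [if_pos hM0, if_neg (hMk i₁ h1 he.symm)]
      exact odd_one
  rw [hcount, ← Finset.add_sum_erase D _ hτ₀] at heven
  exact (Nat.not_even_iff_odd.2 (hτ₀odd.add_even (Finset.even_sum _ hother))) heven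

end Scarf

/-! ### Brouwer's theorem on a simplex -/

section Brouwer

variable {I : Type*} [Fintype I]

/-- Grid points are ranked by their coordinates and Scarf's lemma is applied. `C` consists of the
indices whose artificial point is not in the dominant set, so their colours come from grid points.
Dominance keeps these grid points close together, and near the faces `k ∉ C`. -/
theorem exists_grid_points_near [Nonempty I] (N : ℕ) (c : (I → ℕ) → I) :
    ∃ (C : Set I) (p₀ : I → ℕ), ∑ k, p₀ k = N ∧ (∀ k ∉ C, p₀ k ≤ Fintype.card I) ∧
      ∀ i ∈ C, ∃ p : I → ℕ, ∑ k, p k = N ∧ c p = i ∧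
        ∀ k, p k ≤ p₀ k + Fintype.card I ∧ p₀ k ≤ p k + Fintype.card I := by
  classical
  let X : Type _ := Finset.piAntidiag (Finset.univ : Finset I) N
  have hX : ∀ p : X, ∑ k, p.1 k = N := fun p => (Finset.mem_piAntidiag.1 p.2).1
  have hXle : ∀ (p : X) k, p.1 k ≤ N := fun p k => by
    exact (Finset.single_le_sum (fun _ _ => Nat.zero_le _) (Finset.mem_univ k)).trans_eq (hX p)
  have mkX : ∀ q : I → ℕ, ∑ k, q k = N → ∃ p : X, p.1 = q := fun q hq =>
    ⟨⟨q, Finset.mem_piAntidiag.2 ⟨hq, by simp⟩⟩, rfl⟩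
  obtain ⟨i₁⟩ := id ‹Nonempty I›
  obtain ⟨q₀, -⟩ := mkX (Pi.single i₁ N) (by simp)
  let K : ℤ := Fintype.card X
  let tie : X → ℤ := fun p => (Fintype.equivFin X p : ℕ)
  let num : I → ℤ := fun i => (Fintype.equivFin I i : ℕ)
  have htie0 : ∀ p, 0 ≤ tie p := fun p => by positivity
  have htieK : ∀ p, tie p < K := fun p => by
    simp only [tie, K]; exact_mod_cast (Fintype.equivFin X p).2
  have htie : ∀ p q, tie p = tie q → p = q := fun p q h => by
    simp only [tie, Nat.cast_inj] at h
    exact (Fintype.equivFin X).injective (Fin.ext h)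
  have hnum0 : ∀ i, 0 ≤ num i := fun i => by positivity
  have hnum : ∀ i j, num i = num j → i = j := fun i j h => by
    simp only [num, Nat.cast_inj] at h
    exact (Fintype.equivFin I).injective (Fin.ext h)
  -- The factor `K` exceeds every tie-breaker, so coordinates decide first. Grid values lie in `[0,
  -- K * (N + 1))`, strictly between the two kinds of artificial value.
  let r : I → I ⊕ X → ℤ := fun i =>
    Sum.elim (fun j => if j = i then -1 else K * (N + 1) + num j) (fun p => K * p.1 i + tie p)
  have hK : 0 < K := (htie0 q₀).trans_lt (htieK q₀)
  have hgrid0 : ∀ i p, 0 ≤ r i (Sum.inr p) := fun i p => by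
    have := htie0 p
    simp only [r, Sum.elim_inr]; positivity
  have hgridlt : ∀ i p, r i (Sum.inr p) < K * (N + 1) := fun i p => by
    have h1 := htieK p
    have h2 : (p.1 i : ℤ) ≤ N := by exact_mod_cast hXle p i
    simp only [r, Sum.elim_inr]; nlinarith
  have hown : ∀ i, r i (Sum.inl i) = -1 := fun i => by simp [r]
  have hothers : ∀ i j, j ≠ i → r i (Sum.inl j) = K * (N + 1) + num j := fun i j h => by
    simp [r, h]
  have hbig : ∀ i j, j ≠ i → K * (N + 1) ≤ r i (Sum.inl j) := fun i j h => by
    rw [hothers i j h]; linarith [hnum0 j]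
  have hK1 : 0 < K * (N + 1) := by positivity
  have hlow : ∀ i y, y ≠ Sum.inl i → r i (Sum.inl i) < r i y := by
    rintro i (j | p) hy
    · have := hbig i j fun h => hy (by rw [h])
      rw [hown]; omega
    · have := hgrid0 i p
      rw [hown]; omega
  have hinj : ∀ i, Function.Injective (r i) := by
    intro i x y hxy
    by_cases hx : x = Sum.inl i
    · by_contra hne
      have := hlow i y fun h => hne (hx.trans h.symm)
      rw [← hxy, hx] at this
      exact lt_irrefl _ this
    by_cases hy : y = Sum.inl i
    · have := hlow i x hx
      rw [hxy, hy] at this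
      exact absurd this (lt_irrefl _)
    rcases x with j | p <;> rcases y with k | q
    · rw [hothers i j fun h => hx (by rw [h]), hothers i k fun h => hy (by rw [h])] at hxy
      rw [hnum j k (by linarith)]
    · have h1 := hbig i j fun h => hx (by rw [h])
      have h2 := hgridlt i q
      omega
    · have h1 := hbig i k fun h => hy (by rw [h])
      have h2 := hgridlt i p
      omega
    · have h : K * p.1 i + tie p = K * q.1 i + tie q := hxy
      have h' := congrArg (· % K) h
      simp only [Int.mul_add_emod_self_left, Int.emod_eq_of_lt (htie0 _) (htieK _)] at h'
      rw [htie p q h']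
  obtain ⟨σ, hdom, hcard, himg⟩ := exists_dominant_image_eq_univ hinj (s := Sum.inl) hlow
    (by
      rintro i j (k | p) hj hy
      · exact absurd ⟨k, rfl⟩ hy
      · exact (hgridlt i p).trans_le (hbig i j hj))
    ⟨Sum.inr q₀, by simp⟩ (c := Sum.elim id fun p => c p.1) (fun i => rfl)
  let C : Set I := {i | Sum.inl i ∉ σ}
  have hcol : ∀ i ∈ C, ∃ p : X, Sum.inr p ∈ σ ∧ c p.1 = i := by
    intro i hi
    have : i ∈ σ.image (Sum.elim id fun p : X => c p.1) := by rw [himg]; simp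
    obtain ⟨j | p, hx, hxi⟩ := Finset.mem_image.1 this
    · simp only [Sum.elim_inl, id] at hxi
      exact absurd (hxi ▸ hx) hi
    · exact ⟨p, hx, hxi⟩
  obtain ⟨i₀, hi₀⟩ : ∃ i, i ∈ C := by
    by_contra! hC
    obtain ⟨i, hi⟩ := hdom (Sum.inr q₀)
    have h1 := hi (Sum.inl i) (not_not.1 (hC i))
    have h2 := hgrid0 i q₀
    rw [hown] at h1
    omega
  obtain ⟨p₀, hp₀, -⟩ := hcol i₀ hi₀
  have hmin : ∀ i, ∃ p : X, Sum.inr p ∈ σ ∧ ∀ q : X, Sum.inr q ∈ σ → p.1 i ≤ q.1 i := by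
    intro i
    obtain ⟨p, hp, hpm⟩ := Finset.exists_min_image
      (Finset.univ.filter fun p : X => Sum.inr p ∈ σ) (fun p => p.1 i) ⟨p₀, by simp [hp₀]⟩
    simp only [Finset.mem_filter, Finset.mem_univ, true_and] at hp hpm
    exact ⟨p, hp, hpm⟩
  choose b hbσ hbmin using hmin
  -- For `k ∉ C` the value 0 is what later bounds the coordinate `k` itself.
  let m : I → ℕ := fun k => if k ∈ C then (b k).1 k else 0
  have hmle : ∀ p : X, Sum.inr p ∈ σ → ∀ k, m k ≤ p.1 k := by
    intro p hp k
    simp only [m]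
    split_ifs
    · exact hbmin k p hp
    · exact Nat.zero_le _
  -- Otherwise there is room for a grid point `q` exceeding `m` in every coordinate, the surplus
  -- going to `i₀`. It contradicts dominance: `b i` ranks below `q` if `i ∈ C`, and the artificial
  -- point does if `i ∉ C`.
  have hsum : N < ∑ k, m k + Fintype.card I := by
    by_contra! hle
    have hle' : ∑ k, (m k + 1) ≤ N := by
      rw [Finset.sum_add_distrib]; simpa using hle
    obtain ⟨q, hq⟩ := mkX (fun k => (m k + 1) + if k = i₀ then N - ∑ k, (m k + 1) else 0) (by
      rw [Finset.sum_add_distrib, Finset.sum_ite_eq' Finset.univ i₀, if_pos (Finset.mem_univ _)]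
      omega)
    obtain ⟨i, hi⟩ := hdom (Sum.inr q)
    have hiC : i ∈ C := by
      intro hiσ
      have h1 := hi _ hiσ
      have h2 := hgrid0 i q
      rw [hown] at h1
      omega
    have h1 : K * q.1 i + tie q ≤ K * (b i).1 i + tie (b i) := hi _ (hbσ i)
    have h2 : (b i).1 i + 1 ≤ q.1 i := by
      rw [hq]
      simp only [m, if_pos hiC]
      omega
    have h2' : ((b i).1 i : ℤ) + 1 ≤ q.1 i := by exact_mod_cast h2
    have h3 := htieK (b i)
    have h4 := htie0 q
    nlinarith
  have hclose : ∀ p : X, Sum.inr p ∈ σ → ∀ k, p.1 k ≤ m k + Fintype.card I := by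
    intro p hp k
    have h1 : ∑ j, p.1 j = ∑ j, m j + ∑ j, (p.1 j - m j) := by
      rw [← Finset.sum_add_distrib]
      exact Finset.sum_congr rfl fun j _ => (Nat.add_sub_cancel' (hmle p hp j)).symm
    have h2 : p.1 k - m k ≤ ∑ j, (p.1 j - m j) :=
      Finset.single_le_sum (f := fun j => p.1 j - m j) (fun _ _ => Nat.zero_le _)
        (Finset.mem_univ k)
    rw [hX p] at h1
    omega
  refine ⟨C, p₀.1, hX p₀, fun k hk => ?_, fun i hi => ?_⟩
  · have := hclose p₀ hp₀ k
    simpa only [m, if_neg hk, zero_add] using this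
  · obtain ⟨p, hp, hpc⟩ := hcol i hi
    refine ⟨p.1, hX p, hpc, fun k => ?_⟩
    have h1 := hclose p₀ hp₀ k
    have h2 := hclose p hp k
    have h3 := hmle p₀ hp₀ k
    have h4 := hmle p hp k
    omega

/-- A grid point is coloured by a coordinate that `f` does not decrease; one exists since both
points have coordinate sum 1. For colours in `C`, uniform continuity carries the inequality over
from a nearby grid point. The remaining coordinates are at most `n / N < ε`, while `f` is
nonnegative. -/
theorem exists_le_apply_add {f : (I → ℝ) → I → ℝ} (hf : ContinuousOn f (stdSimplex ℝ I))
    (hmaps : Set.MapsTo f (stdSimplex ℝ I) (stdSimplex ℝ I)) [Nonempty I] {ε : ℝ} (hε : 0 < ε) :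
    ∃ z ∈ stdSimplex ℝ I, ∀ k, z k ≤ f z k + ε := by
  classical
  obtain ⟨δ, hδ, huc⟩ := Metric.uniformContinuousOn_iff.1
    ((isCompact_stdSimplex ℝ I).uniformContinuousOn_of_continuous hf) (ε / 2) (by positivity)
  set n := Fintype.card I with hn
  obtain ⟨N, hN⟩ := exists_nat_gt (n / min δ (ε / 2))
  have hm : 0 < min δ (ε / 2) := by positivity
  have hNpos : (0 : ℝ) < N := lt_of_le_of_lt (by positivity) hN
  have hnN : (n : ℝ) / N < min δ (ε / 2) := by
    rw [div_lt_iff₀ hNpos]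
    rw [div_lt_iff₀ hm] at hN
    linarith
  let e : (I → ℕ) → I → ℝ := fun p k => p k / N
  have he : ∀ p : I → ℕ, ∑ k, p k = N → e p ∈ stdSimplex ℝ I := by
    intro p hp
    refine ⟨fun k => by positivity, ?_⟩
    simp only [e]
    rw [← Finset.sum_div, div_eq_one_iff_eq hNpos.ne', ← hp]
    push_cast
    rfl
  have hcol : ∀ p : I → ℕ, ∃ i, ∑ k, p k = N → e p i ≤ f (e p) i := by
    intro p
    by_cases hp : ∑ k, p k = N
    · by_contra! hlt
      have h1 : ∑ i, f (e p) i < ∑ i, e p i :=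
        Finset.sum_lt_sum_of_nonempty Finset.univ_nonempty fun i _ => (hlt i).2
      rw [(he p hp).2, (hmaps (he p hp)).2] at h1
      exact lt_irrefl _ h1
    · exact ⟨Classical.arbitrary I, fun h => absurd h hp⟩
  choose c hc using hcol
  obtain ⟨C, p₀, hp₀, hzero, hnear⟩ := exists_grid_points_near N c
  refine ⟨e p₀, he p₀ hp₀, fun k => ?_⟩
  by_cases hk : k ∈ C
  · obtain ⟨p, hp, hpc, hpn⟩ := hnear k hk
    have hcl : ∀ j, |e p j - e p₀ j| ≤ n / N := by
      intro j
      obtain ⟨h1, h2⟩ := hpn j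
      have h1' : (p j : ℝ) ≤ p₀ j + n := by exact_mod_cast h1
      have h2' : (p₀ j : ℝ) ≤ p j + n := by exact_mod_cast h2
      simp only [e]
      rw [← sub_div, abs_div, abs_of_pos hNpos]
      gcongr
      rw [abs_le]
      constructor <;> linarith
    have hdist : dist (e p) (e p₀) < δ := by
      rw [dist_pi_lt_iff hδ]
      intro j
      rw [Real.dist_eq]
      exact (hcl j).trans_lt (hnN.trans_le (min_le_left _ _))
    have h1 := (dist_le_pi_dist (f (e p)) (f (e p₀)) k).trans_lt
      (huc _ (he p hp) _ (he p₀ hp₀) hdist)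
    rw [Real.dist_eq, abs_lt] at h1
    have h2 := hc p hp
    rw [hpc] at h2
    have h3 := (abs_le.1 (hcl k)).1
    have h4 := min_le_right δ (ε / 2)
    linarith
  · have h1 : (p₀ k : ℝ) ≤ n := by exact_mod_cast hzero k hk
    have h2 : e p₀ k ≤ n / N := by simp only [e]; gcongr
    have h3 := (hmaps (he p₀ hp₀)).1 k
    have h4 := min_le_right δ (ε / 2)
    linarith

/-- Brouwer's fixed point theorem for the standard simplex. -/
theorem exists_fixedPoint_stdSimplex [Nonempty I] {f : (I → ℝ) → I → ℝ}
    (hf : ContinuousOn f (stdSimplex ℝ I))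
    (hmaps : Set.MapsTo f (stdSimplex ℝ I) (stdSimplex ℝ I)) :
    ∃ x ∈ stdSimplex ℝ I, f x = x := by
  classical
  have hcomp : ∀ k, ContinuousOn (fun x => f x k) (stdSimplex ℝ I) := fun k =>
    (continuous_apply k).comp_continuousOn hf
  -- The minimised quantity is the total decrease under `f`. Its minimum is 0 by the approximate
  -- result, and a point with no decreasing coordinate is fixed because coordinate sums agree.
  obtain ⟨x, hx, hmin⟩ := (isCompact_stdSimplex ℝ I).exists_isMinOn
    ⟨_, single_mem_stdSimplex ℝ (Classical.arbitrary I)⟩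
    (f := fun x => ∑ k, max 0 (x k - f x k))
    (continuousOn_finsetSum _ fun k _ => continuousOn_const.sup
      ((continuous_apply k).continuousOn.sub (hcomp k)))
  refine ⟨x, hx, ?_⟩
  have hle : ∑ k, max 0 (x k - f x k) ≤ 0 := by
    refine le_of_forall_pos_le_add fun ε hε => ?_
    have hcard : (0 : ℝ) < Fintype.card I := by exact_mod_cast Fintype.card_pos
    obtain ⟨z, hz, hzk⟩ := exists_le_apply_add hf hmaps (ε := ε / Fintype.card I) (by positivity)
    refine (hmin hz).trans ?_
    calc ∑ k, max 0 (z k - f z k) ≤ ∑ _k : I, ε / Fintype.card I :=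
          Finset.sum_le_sum fun k _ => max_le (by positivity) (by linarith [hzk k])
      _ = 0 + ε := by
          rw [Finset.sum_const, Finset.card_univ, nsmul_eq_mul, mul_div_cancel₀ _ hcard.ne',
            zero_add]
  have hk : ∀ k, x k ≤ f x k := fun k => by
    have h1 := (Finset.single_le_sum (f := fun k => max 0 (x k - f x k))
      (fun _ _ => le_max_left _ _) (Finset.mem_univ k)).trans hle
    linarith [le_max_right 0 (x k - f x k)]
  have hsum : ∑ k, x k = ∑ k, f x k := by rw [hx.2, (hmaps hx).2]
  exact funext fun k => ((Finset.sum_eq_sum_iff_of_le fun k _ => hk k).1 hsum k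
    (Finset.mem_univ k)).symm

end Brouwer

/-! ### Nash equilibrium from Brouwer's theorem -/

section Equilibrium

variable {A B : Type*} [Fintype A] [Fintype B] [Nonempty B]

/-- Brouwer's fixed point theorem for a product of standard simplices. -/
theorem exists_fixedPoint_pi_stdSimplex {F : (A → stdSimplex ℝ B) → A → stdSimplex ℝ B}
    (hF : Continuous F) : ∃ σ, F σ = σ := by
  classical
  rcases isEmpty_or_nonempty A with hA | hA
  · exact ⟨fun a => isEmptyElim a, Subsingleton.elim _ _⟩
  have hn : (0 : ℝ) < Fintype.card A := by exact_mod_cast Fintype.card_pos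
  have hb : (0 : ℝ) < Fintype.card B := by exact_mod_cast Fintype.card_pos
  set n : ℝ := (Fintype.card A : ℝ) with hn_def
  set b : ℝ := (Fintype.card B : ℝ) with hb_def
  let q : (A × B → ℝ) → A → B → ℝ := fun p a x => n * |p (a, x)|
  let w : (A × B → ℝ) → A → ℝ := fun p a => ∑ x, q p a x
  have hq : ∀ p a x, 0 ≤ q p a x := fun p a x => by positivity
  have hmax : ∀ p a, 0 < max (w p a) 1 := fun p a => lt_max_of_lt_right one_pos
  -- The product sits inside the simplex over `A × B` with weight `1 / n` in each row. `ρ` maps back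
  -- continuously: a row of mass below 1 is filled up evenly, a heavier one is rescaled. At the
  -- fixed point every row has mass 1 and neither correction acts.
  let ρ : (A × B → ℝ) → A → stdSimplex ℝ B := fun p a =>
    ⟨fun x => (q p a x + max 0 (1 - w p a) / b) / max (w p a) 1, by
      refine ⟨fun x => div_nonneg (add_nonneg (hq p a x)
        (div_nonneg (le_max_left _ _) hb.le)) (hmax p a).le, ?_⟩
      rw [← Finset.sum_div, div_eq_one_iff_eq (hmax p a).ne', Finset.sum_add_distrib,
        Finset.sum_const, Finset.card_univ, nsmul_eq_mul, mul_div_cancel₀ _ hb.ne']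
      change w p a + _ = _
      rcases le_total (w p a) 1 with h | h
      · rw [max_eq_right h, max_eq_right (by linarith)]; ring
      · rw [max_eq_left h, max_eq_left (by linarith)]; ring⟩
  have hρ : Continuous ρ := by
    refine continuous_pi fun a => Continuous.subtype_mk (continuous_pi fun x => ?_) _
    have hqc : ∀ x, Continuous fun p => q p a x := fun x =>
      continuous_const.mul (continuous_apply (a, x)).abs
    have hwc : Continuous fun p => w p a := continuous_finsetSum _ fun x _ => hqc x
    exact ((hqc x).add ((continuous_const.max (continuous_const.sub hwc)).div_const _)).div
      (hwc.max continuous_const) fun p => (hmax p a).ne'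
  have hcont : Continuous fun (p : A × B → ℝ) (ax : A × B) =>
      F (ρ p) ax.1 ax.2 / n := by
    refine continuous_pi fun ax => Continuous.div_const ?_ _
    exact (continuous_apply ax.2).comp
      (continuous_subtype_val.comp ((continuous_apply ax.1).comp (hF.comp hρ)))
  obtain ⟨p, -, hp⟩ := exists_fixedPoint_stdSimplex hcont.continuousOn (by
    intro p _
    refine ⟨fun ax => div_nonneg (stdSimplex.zero_le (F (ρ p) ax.1) _) hn.le, ?_⟩
    rw [Fintype.sum_prod_type]
    simp only [← Finset.sum_div]
    rw [div_eq_one_iff_eq hn.ne', Finset.sum_congr rfl fun a _ => stdSimplex.sum_eq_one (F (ρ p) a)]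
    simp [n])
  refine ⟨ρ p, ?_⟩
  have hqF : ∀ a x, q p a x = F (ρ p) a x := by
    intro a x
    have h : F (ρ p) a x / n = p (a, x) := congrFun hp (a, x)
    simp only [q]
    rw [← h, abs_of_nonneg (div_nonneg (stdSimplex.zero_le (F (ρ p) a) _) hn.le), mul_div_cancel₀ _ hn.ne']
  have hw : ∀ a, w p a = 1 := fun a => by
    simp only [w, hqF]
    exact stdSimplex.sum_eq_one (F (ρ p) a)
  funext a
  refine Subtype.ext (funext fun x => ?_)
  change _ = (q p a x + max 0 (1 - w p a) / b) / max (w p a) 1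
  rw [hw, hqF, sub_self, max_self, max_self, zero_div, add_zero, div_one]
  rfl

/-- Existence of equilibria in games with finitely many players and actions: there is a mixed
strategy profile that only plays optimal actions. -/
theorem exists_mixed_equilibrium {W : (A → stdSimplex ℝ B) → A → B → ℝ} (hW : Continuous W) :
    ∃ σ : A → stdSimplex ℝ B, ∀ a x, 0 < σ a x → ∀ x', W σ a x' ≤ W σ a x := by
  classical
  let avg : (A → stdSimplex ℝ B) → A → ℝ := fun σ a => ∑ x, σ a x * W σ a x
  let gain : (A → stdSimplex ℝ B) → A → B → ℝ := fun σ a x => max 0 (W σ a x - avg σ a)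
  have hgain : ∀ σ a x, 0 ≤ gain σ a x := fun σ a x => le_max_left _ _
  have hsum : ∀ σ a, 0 ≤ ∑ x, gain σ a x := fun σ a => Finset.sum_nonneg fun x _ => hgain σ a x
  have hpos : ∀ σ a, 0 < 1 + ∑ x, gain σ a x := fun σ a => by linarith [hsum σ a]
  -- Nash's map: weight shifts towards actions that do better than the average.
  let F : (A → stdSimplex ℝ B) → A → stdSimplex ℝ B := fun σ a =>
    ⟨fun x => (σ a x + gain σ a x) / (1 + ∑ x, gain σ a x), by
      refine ⟨fun x => div_nonneg (add_nonneg ((σ a).2.1 x) (hgain σ a x)) (hpos σ a).le, ?_⟩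
      rw [← Finset.sum_div, div_eq_one_iff_eq (hpos σ a).ne', Finset.sum_add_distrib,
        stdSimplex.sum_eq_one]⟩
  have hF : Continuous F := by
    refine continuous_pi fun a => Continuous.subtype_mk (continuous_pi fun x => ?_) _
    have hσ : ∀ x, Continuous fun σ : A → stdSimplex ℝ B => σ a x := fun x =>
      (continuous_apply x).comp (continuous_subtype_val.comp (continuous_apply a))
    have hWc : ∀ x, Continuous fun σ => W σ a x := fun x =>
      (continuous_apply x).comp ((continuous_apply a).comp hW)
    have havg : Continuous fun σ => avg σ a :=
      continuous_finsetSum _ fun x _ => (hσ x).mul (hWc x)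
    have hg : ∀ x, Continuous fun σ => gain σ a x := fun x =>
      continuous_const.max ((hWc x).sub havg)
    exact ((hσ x).add (hg x)).div
      (continuous_const.add (continuous_finsetSum _ fun x _ => hg x)) fun σ => (hpos σ a).ne'
  obtain ⟨σ, hσ⟩ := exists_fixedPoint_pi_stdSimplex hF
  refine ⟨σ, fun a x hx x' => ?_⟩
  have hfix : ∀ y, gain σ a y = σ a y * ∑ x, gain σ a x := by
    intro y
    have h : (σ a y + gain σ a y) / (1 + ∑ x, gain σ a x) = σ a y :=
      congrFun (congrArg Subtype.val (congrFun hσ a)) y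
    rw [div_eq_iff (hpos σ a).ne'] at h
    linarith
  have hone := stdSimplex.sum_eq_one (σ a)
  -- If the total gain were positive, the fixed-point equation would give every action in use a
  -- positive gain, so that all of them would beat their own average.
  have hzero : ∑ y, gain σ a y = 0 := by
    by_contra hne
    have hall : ∀ y, 0 < σ a y → avg σ a < W σ a y := by
      intro y hy
      have : 0 < gain σ a y := by
        rw [hfix y]; exact mul_pos hy (lt_of_le_of_ne (hsum σ a) (Ne.symm hne))
      by_contra! hle
      simp only [gain] at this
      rw [max_eq_left (by linarith)] at this
      exact lt_irrefl _ this
    have : ∑ y, σ a y * avg σ a < ∑ y, σ a y * W σ a y := by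
      refine Finset.sum_lt_sum (fun y _ => ?_) ⟨x, Finset.mem_univ _, ?_⟩
      · rcases (stdSimplex.zero_le (σ a) y).eq_or_lt with h | h
        · rw [← h]; simp
        · exact mul_le_mul_of_nonneg_left (hall y h).le h.le
      · exact mul_lt_mul_of_pos_left (hall x hx) hx
    rw [← Finset.sum_mul, hone, one_mul] at this
    exact lt_irrefl _ this
  have hle : ∀ y, W σ a y ≤ avg σ a := fun y => by
    have h := hfix y
    rw [hzero, mul_zero] at h
    have := le_max_right 0 (W σ a y - avg σ a)
    change _ ≤ gain σ a y at this
    linarith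
  have heq : ∑ y, σ a y * W σ a y = ∑ y, σ a y * avg σ a := by
    rw [← Finset.sum_mul, hone, one_mul]
  have hxe := (Finset.sum_eq_sum_iff_of_le fun y _ =>
    mul_le_mul_of_nonneg_left (hle y) (stdSimplex.zero_le (σ a) y)).1 heq x (Finset.mem_univ x)
  rw [mul_left_cancel₀ hx.ne' hxe]
  exact hle x'

end Equilibrium

namespace KyleGame

variable {G : KyleGame}

/-! ### The one-shot deviation principle -/

/-- The probability of the trades along `ω` from round `t` on. -/
def tailProb (ξ : G.BehaviourStrategy) (t : ℕ) (ω : G.Outcome) : ℝ :=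
  ∏ s ∈ Finset.univ.filter (fun s : Fin G.T => t ≤ (s : ℕ)),
    ξ (ω.insiderNode s) (ω.x s) * G.ζ (ω.z s)

theorem tailProb_eq_mul (ξ : G.BehaviourStrategy) (t : Fin G.T) (ω : G.Outcome) :
    tailProb ξ t ω =
      ξ (ω.insiderNode t) (ω.x t) * G.ζ (ω.z t) * tailProb ξ (t + 1) ω := by
  have h : Finset.univ.filter (fun s : Fin G.T => (t : ℕ) ≤ (s : ℕ)) =
      insert t (Finset.univ.filter fun s : Fin G.T => (t : ℕ) + 1 ≤ (s : ℕ)) := by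
    ext s
    simp only [Finset.mem_filter, Finset.mem_univ, true_and, Finset.mem_insert, Fin.ext_iff]
    omega
  rw [tailProb, h, Finset.prod_insert (by simp)]
  rfl

open Classical in
/-- The expected utility after the history `h`, up to normalisation. -/
def continuationValue (ξ : G.BehaviourStrategy) (S : G.PricingSystem) (t : ℕ) (ht : t ≤ G.T)
    (h : G.Hist t t) : ℝ :=
  ∑ ω : G.Outcome with Hist.trunc ω t t (by omega) (by omega) = h,
    G.ν (Outcome.state ω) * tailProb ξ t ω * payoff ω S

open Classical in
/-- The expected utility of trading `x` at an insider node and playing `ξ` afterwards, up to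
normalisation. -/
def actionValue (ξ : G.BehaviourStrategy) (S : G.PricingSystem) (t : Fin G.T)
    (k : G.Hist (t + 1) t) (x : G.EX) : ℝ :=
  ∑ ω : G.Outcome with Hist.trunc ω (t + 1) t (by omega) (by omega) = k ∧ ω.x t = x,
    G.ν (Outcome.state ω) * (G.ζ (ω.z t) * tailProb ξ (t + 1) ω) * payoff ω S

/-- The denominator does not depend on the strategy, so optimality can be compared without
normalisation. -/
theorem subgameUtility_eq_div (ξ : G.BehaviourStrategy) (S : G.PricingSystem) (τ : G.InfoNode) :
    subgameUtility ξ S τ =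
      continuationValue ξ S τ.1 (by omega) τ.2 / ∑ j ∈ τ.attainable, G.ν j := by
  rw [subgameUtility, continuationValue, Finset.sum_div]
  refine Finset.sum_congr rfl fun ω _ => ?_
  rw [subgameProb, tailProb]
  ring

-- One half of the backward recursion: outcomes are sorted by the next revealed block and the trade
-- there. The other half, `actionValue_eq_sum_continuationValue`, resolves the noise trade.
open Classical in
theorem continuationValue_eq_sum_actionValue (ξ : G.BehaviourStrategy) (S : G.PricingSystem)
    (t : Fin G.T) (h : G.Hist t t) :
    continuationValue ξ S t t.2.le h =
      ∑ k : G.Hist (t + 1) t with Hist.trunc k t t (by omega) le_rfl = h,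
        ∑ x, ξ ⟨t, k⟩ x * actionValue ξ S t k x := by
  rw [continuationValue, ← Finset.sum_fiberwise_of_maps_to
    (g := fun ω : G.Outcome => Hist.trunc ω (t + 1) t (by omega) (by omega))
    (t := Finset.univ.filter fun k : G.Hist (t + 1) t => Hist.trunc k t t (by omega) le_rfl = h)
    (fun ω hω => by
      simp only [Finset.mem_filter, Finset.mem_univ, true_and] at hω ⊢
      exact hω)]
  refine Finset.sum_congr rfl fun k hk => ?_
  rw [← Finset.sum_fiberwise (g := fun ω : G.Outcome => ω.x t)]
  refine Finset.sum_congr rfl fun x _ => ?_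
  rw [actionValue, Finset.mul_sum]
  have hk' := (Finset.mem_filter.1 hk).2
  refine Finset.sum_congr ?_ fun ω hω => ?_
  · ext ω
    simp only [Finset.mem_filter, Finset.mem_univ, true_and]
    constructor
    · rintro ⟨⟨-, h1⟩, h2⟩
      exact ⟨h1, h2⟩
    · rintro ⟨h1, h2⟩
      exact ⟨⟨by rw [← hk', ← h1]; rfl, h1⟩, h2⟩
  · simp only [Finset.mem_filter, Finset.mem_univ, true_and] at hω
    have hnode : ω.insiderNode t = ⟨t, k⟩ := by rw [← hω.1]; rfl
    rw [tailProb_eq_mul, hnode, hω.2]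
    ring

open Classical in
theorem actionValue_eq_sum_continuationValue (ξ : G.BehaviourStrategy) (S : G.PricingSystem)
    (t : Fin G.T) (k : G.Hist (t + 1) t) (x : G.EX) :
    actionValue ξ S t k x =
      ∑ h : G.Hist (t + 1) (t + 1) with
        Hist.trunc h (t + 1) t le_rfl (by omega) = k ∧ h.x (Fin.last t) = x,
        G.ζ (h.z (Fin.last t)) * continuationValue ξ S (t + 1) t.2 h := by
  rw [actionValue, ← Finset.sum_fiberwise_of_maps_to
    (g := fun ω : G.Outcome => Hist.trunc ω (t + 1) (t + 1) (by omega) (by omega))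
    (t := Finset.univ.filter fun h : G.Hist (t + 1) (t + 1) =>
      Hist.trunc h (t + 1) t le_rfl (by omega) = k ∧ h.x (Fin.last t) = x)
    (fun ω hω => by
      simp only [Finset.mem_filter, Finset.mem_univ, true_and] at hω ⊢
      exact hω)]
  refine Finset.sum_congr rfl fun h hh => ?_
  rw [continuationValue, Finset.mul_sum]
  have hh' := (Finset.mem_filter.1 hh).2
  refine Finset.sum_congr ?_ fun ω hω => ?_
  · ext ω
    simp only [Finset.mem_filter, Finset.mem_univ, true_and]
    constructor
    · rintro ⟨-, h1⟩
      exact h1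
    · intro h1
      exact ⟨by rw [← hh'.1, ← hh'.2, ← h1]; exact ⟨rfl, rfl⟩, h1⟩
  · simp only [Finset.mem_filter, Finset.mem_univ, true_and] at hω
    have hz : ω.z t = h.z (Fin.last t) := by rw [← hω]; rfl
    rw [hz]
    ring

/-- A strategy that only uses optimal actions at each insider node, given its own continuation, is
optimal after every history. -/
theorem continuationValue_le {ξ : G.BehaviourStrategy} {S : G.PricingSystem}
    (hξ : ∀ (t : Fin G.T) (k : G.Hist (t + 1) t) (x : G.EX), 0 < ξ ⟨t, k⟩ x →
      ∀ x', actionValue ξ S t k x' ≤ actionValue ξ S t k x)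
    (ξ' : G.BehaviourStrategy) :
    ∀ (d t : ℕ) (ht : t ≤ G.T), t + d = G.T → ∀ h : G.Hist t t,
      continuationValue ξ' S t ht h ≤ continuationValue ξ S t ht h := by
  classical
  intro d
  induction d with
  | zero =>
    intro t ht htd h
    have : Finset.univ.filter (fun s : Fin G.T => t ≤ (s : ℕ)) = ∅ := by
      ext s
      simp only [Finset.mem_filter, Finset.mem_univ, true_and, Finset.notMem_empty, iff_false]
      omega
    simp only [continuationValue, tailProb, this, Finset.prod_empty, le_refl]
  | succ d ih =>
    intro t ht htd h
    obtain ⟨t, rfl⟩ : ∃ s : Fin G.T, (s : ℕ) = t := ⟨⟨t, by omega⟩, rfl⟩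
    rw [continuationValue_eq_sum_actionValue, continuationValue_eq_sum_actionValue]
    refine Finset.sum_le_sum fun k _ => ?_
    -- After the current trade only later play matters, where the induction hypothesis applies.
    have hact : ∀ x, actionValue ξ' S t k x ≤ actionValue ξ S t k x := fun x => by
      rw [actionValue_eq_sum_continuationValue, actionValue_eq_sum_continuationValue]
      exact Finset.sum_le_sum fun h' _ => mul_le_mul_of_nonneg_left
        (ih (t + 1) t.2 (by omega) h') (stdSimplex.zero_le _ _)
    obtain ⟨x₀, hx₀⟩ : ∃ x, 0 < ξ ⟨t, k⟩ x := by
      by_contra! hle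
      have := stdSimplex.sum_eq_one (ξ ⟨t, k⟩)
      linarith [Finset.sum_nonpos fun x (_ : x ∈ Finset.univ) => hle x]
    have hopt : ∀ x, ξ ⟨t, k⟩ x * actionValue ξ S t k x =
        ξ ⟨t, k⟩ x * actionValue ξ S t k x₀ := fun x => by
      rcases (stdSimplex.zero_le (ξ ⟨t, k⟩) x).eq_or_lt with h0 | h0
      · rw [← h0, zero_mul, zero_mul]
      · rw [le_antisymm (hξ t k x₀ hx₀ x) (hξ t k x h0 x₀)]
    calc ∑ x, ξ' ⟨t, k⟩ x * actionValue ξ' S t k x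
        ≤ ∑ x, ξ' ⟨t, k⟩ x * actionValue ξ S t k x₀ :=
          Finset.sum_le_sum fun x _ => mul_le_mul_of_nonneg_left
            ((hact x).trans (hξ t k x₀ hx₀ x)) (stdSimplex.zero_le _ _)
      _ = ∑ x, ξ ⟨t, k⟩ x * actionValue ξ S t k x₀ := by
          rw [← Finset.sum_mul, ← Finset.sum_mul, stdSimplex.sum_eq_one, stdSimplex.sum_eq_one]
      _ = ∑ x, ξ ⟨t, k⟩ x * actionValue ξ S t k x :=
          Finset.sum_congr rfl fun x _ => (hopt x).symm

theorem isSubgameOptimal_of_actionValue_le {ξ : G.BehaviourStrategy} {S : G.PricingSystem}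
    (hξ : ∀ (t : Fin G.T) (k : G.Hist (t + 1) t) (x : G.EX), 0 < ξ ⟨t, k⟩ x →
      ∀ x', actionValue ξ S t k x' ≤ actionValue ξ S t k x) :
    IsSubgameOptimal ξ S := fun τ ξ' => by
  rw [subgameUtility_eq_div, subgameUtility_eq_div]
  exact div_le_div_of_nonneg_right
    (continuationValue_le hξ ξ' (G.T - τ.1) τ.1 (by omega) (by omega) τ.2)
    (Finset.sum_nonneg fun j _ => stdSimplex.zero_le _ _)

/-! ### Bayesian beliefs for completely mixed strategies -/

/-- The blocks containing a fixed state form an admissible chain, including the final singleton.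
This supplies the information part of an outcome. -/
theorem antitone_part (i : Fin G.N) : Antitone fun s : ℕ => (G.partition s).part i := by
  refine antitone_nat_of_succ_le fun s => ?_
  have hi : i ∈ (G.partition s).part i := Finpartition.mem_part _ (Finset.mem_univ i)
  by_cases hs : s + 1 < G.T
  · have hs' : s < G.T := by omega
    have hp : (G.partition (s + 1)).part i ∈ (G.info ⟨s + 1, hs⟩).parts := by
      have := Finpartition.part_mem (G.partition (s + 1)) |>.2 (Finset.mem_univ i)
      rwa [partition, dif_pos hs] at this ⊢
    obtain ⟨B, hB, hsub⟩ := G.info_refining ⟨s, hs'⟩ ⟨s + 1, hs⟩ rfl _ hp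
    have hB' : B ∈ (G.partition s).parts := by rwa [partition, dif_pos hs']
    have hiB : i ∈ B := hsub (Finpartition.mem_part _ (Finset.mem_univ i))
    rw [Finpartition.part_eq_of_mem _ hB' hiB]
    exact hsub
  · have hp := Finpartition.part_mem (G.partition (s + 1)) |>.2 (Finset.mem_univ i)
    have hmem : i ∈ (G.partition (s + 1)).part i := Finpartition.mem_part _ (Finset.mem_univ i)
    generalize (G.partition (s + 1)).part i = P at hp hmem
    rw [partition, dif_neg hs, Finpartition.mem_bot_iff] at hp
    obtain ⟨j, -, rfl⟩ := hp
    rw [Finset.mem_singleton] at hmem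
    subst hmem
    exact Finset.singleton_subset_iff.2 hi

theorem exists_outcome_orderFlow_eq {t : Fin G.T} (y : G.OrderFlow t) :
    ∃ ω : G.Outcome, ω.orderFlow t = y := by
  have hy : ∀ s, ∃ (x : G.EX) (z : G.EZ), (x : ℝ) + z = y s := fun s => by
    obtain ⟨x, hx, z, hz, h⟩ := Finset.mem_image₂.1 (y s).2
    exact ⟨⟨x, hx⟩, ⟨z, hz⟩, h⟩
  choose x z hxz using hy
  let i : Fin G.N := ⟨0, G.N_pos⟩
  -- Trades after round `t` are arbitrary; `min s t` repeats the last prescribed one.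
  refine ⟨⟨fun s => (G.partition s).part i,
    fun s => Finpartition.part_mem _ |>.2 (Finset.mem_univ i),
    fun s s' h => antitone_part i h,
    fun s => x ⟨min s t, by omega⟩, fun s => z ⟨min s t, by omega⟩⟩, ?_⟩
  funext s
  apply Subtype.ext
  rw [← hxz]
  have : (⟨min (s : ℕ) t, by omega⟩ : Fin (t + 1)) = s := Fin.ext (by simp; omega)
  simp only [Outcome.orderFlow, Fin.val_castLE, this]

theorem IsCompletelyMixed.prob_pos {ξ : G.BehaviourStrategy} (hξ : IsCompletelyMixed ξ)
    (ω : G.Outcome) : 0 < prob ξ ω :=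
  mul_pos (G.ν_pos _) (Finset.prod_pos fun _ _ => mul_pos (hξ _ _) (G.ζ_pos _))

theorem IsCompletelyMixed.jointProb_nonneg {ξ : G.BehaviourStrategy} (hξ : IsCompletelyMixed ξ)
    {t : Fin G.T} (i : Fin G.N) (y : G.OrderFlow t) : 0 ≤ jointProb ξ i y :=
  Finset.sum_nonneg fun ω _ => (hξ.prob_pos ω).le

/-- Every order flow occurs along some outcome, and every outcome has positive probability. Thus
Bayes' rule leaves no belief free, and its denominators never vanish. -/
theorem IsCompletelyMixed.flowProb_pos {ξ : G.BehaviourStrategy} (hξ : IsCompletelyMixed ξ)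
    {t : Fin G.T} (y : G.OrderFlow t) : 0 < flowProb ξ y := by
  obtain ⟨ω, hω⟩ := exists_outcome_orderFlow_eq y
  refine Finset.sum_pos' (fun i _ => hξ.jointProb_nonneg i y)
    ⟨ω.state, Finset.mem_univ _, Finset.sum_pos (fun ω _ => hξ.prob_pos ω) ⟨ω, ?_⟩⟩
  simp [hω]

/-- The beliefs determined by Bayes' rule. -/
def bayesBeliefs (ξ : G.BehaviourStrategy) (hξ : IsCompletelyMixed ξ) : G.Beliefs := fun t y =>
  ⟨fun i => jointProb ξ i y / flowProb ξ y,
    fun i => div_nonneg (hξ.jointProb_nonneg i y) (hξ.flowProb_pos y).le, by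
      rw [← Finset.sum_div]
      exact div_self (hξ.flowProb_pos y).ne'⟩

theorem isRational_bayesBeliefs {ξ : G.BehaviourStrategy} (hξ : IsCompletelyMixed ξ) :
    IsRational (bayesBeliefs ξ hξ) ξ := fun _ _ _ _ => rfl

/-! ### Continuity -/

theorem continuous_strategy_apply (κ : G.InsiderNode) (x : G.EX) :
    Continuous fun ξ : G.BehaviourStrategy => ξ κ x :=
  (continuous_apply x).comp (continuous_subtype_val.comp (continuous_apply κ))

theorem continuous_beliefs_apply (t : Fin G.T) (y : G.OrderFlow t) (i : Fin G.N) :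
    Continuous fun μ : G.Beliefs => μ t y i :=
  (continuous_apply i).comp
    (continuous_subtype_val.comp ((continuous_apply y).comp (continuous_apply t)))

theorem continuous_tailProb (t : ℕ) (ω : G.Outcome) :
    Continuous fun ξ : G.BehaviourStrategy => tailProb ξ t ω :=
  continuous_finsetProd _ fun _ _ => (continuous_strategy_apply _ _).mul continuous_const

theorem continuous_pricing (t : Fin G.T) (y : G.OrderFlow t) :
    Continuous fun μ : G.Beliefs => (pricing μ t y : ℝ) := by
  have h : Continuous fun μ : G.Beliefs => ∑ i, μ t y i * G.v i :=
    continuous_finsetSum _ fun i _ => (continuous_beliefs_apply t y i).mul continuous_const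
  exact h

theorem continuous_payoff_pricing (ω : G.Outcome) :
    Continuous fun μ : G.Beliefs => payoff ω (pricing μ) :=
  continuous_finsetSum _ fun t _ =>
    (continuous_const.sub (continuous_pricing t (ω.orderFlow t))).mul continuous_const

/-- Stated for a general filter because it gives both the continuity of `trembleValue` and the final
passage to the limit. -/
theorem tendsto_actionValue {Y : Type*} {l : Filter Y} {ξs : Y → G.BehaviourStrategy}
    {μs : Y → G.Beliefs} {ξ : G.BehaviourStrategy} {μ : G.Beliefs} (hξ : Tendsto ξs l (𝓝 ξ))
    (hμ : Tendsto μs l (𝓝 μ)) (t : Fin G.T) (k : G.Hist (t + 1) t) (x : G.EX) :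
    Tendsto (fun y => actionValue (ξs y) (pricing (μs y)) t k x) l
      (𝓝 (actionValue ξ (pricing μ) t k x)) := by
  simp only [actionValue]
  exact tendsto_finsetSum _ fun ω _ => (tendsto_const_nhds.mul
    (tendsto_const_nhds.mul (((continuous_tailProb _ ω).tendsto ξ).comp hξ))).mul
      (((continuous_payoff_pricing ω).tendsto μ).comp hμ)

theorem continuous_jointProb {t : Fin G.T} (i : Fin G.N) (y : G.OrderFlow t) :
    Continuous fun ξ : G.BehaviourStrategy => jointProb ξ i y :=
  continuous_finsetSum _ fun _ _ => continuous_const.mul (continuous_finsetProd _ fun _ _ =>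
    (continuous_strategy_apply _ _).mul continuous_const)

theorem continuous_bayesBeliefs {Y : Type*} [TopologicalSpace Y] {P : Y → G.BehaviourStrategy}
    (hP : Continuous P) (hmix : ∀ σ, IsCompletelyMixed (P σ)) :
    Continuous fun σ => bayesBeliefs (P σ) (hmix σ) := by
  refine continuous_pi fun t => continuous_pi fun y =>
    Continuous.subtype_mk (continuous_pi fun i => ?_) _
  exact ((continuous_jointProb i y).comp hP).div
    (continuous_finsetSum _ fun j _ => (continuous_jointProb j y).comp hP)
    fun σ => ((hmix σ).flowProb_pos y).ne'

/-! ### Trembles -/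

/-- The strategy that trembles with probability `ε`, uniformly over all trades. -/
def tremble (ε : ℝ) (h0 : 0 < ε) (h1 : ε ≤ 1) (σ : G.BehaviourStrategy) : G.BehaviourStrategy :=
  fun κ => ⟨fun x => (1 - ε) * σ κ x + ε / Fintype.card G.EX, by
    have hne : Nonempty G.EX := G.EX_nonempty.to_subtype
    have hc : (0 : ℝ) < Fintype.card G.EX := by exact_mod_cast Fintype.card_pos
    refine ⟨fun x => add_nonneg (mul_nonneg (by linarith) (stdSimplex.zero_le _ _))
      (by positivity), ?_⟩
    rw [Finset.sum_add_distrib, ← Finset.mul_sum, stdSimplex.sum_eq_one, Finset.sum_const,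
      Finset.card_univ, nsmul_eq_mul, mul_div_cancel₀ _ hc.ne']
    ring⟩

theorem tremble_apply (ε : ℝ) (h0 : 0 < ε) (h1 : ε ≤ 1) (σ : G.BehaviourStrategy)
    (κ : G.InsiderNode) (x : G.EX) :
    tremble ε h0 h1 σ κ x = (1 - ε) * σ κ x + ε / Fintype.card G.EX := rfl

theorem isCompletelyMixed_tremble (ε : ℝ) (h0 : 0 < ε) (h1 : ε ≤ 1) (σ : G.BehaviourStrategy) :
    IsCompletelyMixed (tremble ε h0 h1 σ) := fun κ x => by
  have hne : Nonempty G.EX := G.EX_nonempty.to_subtype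
  have hc : (0 : ℝ) < Fintype.card G.EX := by exact_mod_cast Fintype.card_pos
  rw [tremble_apply]
  exact add_pos_of_nonneg_of_pos (mul_nonneg (by linarith) (stdSimplex.zero_le _ _))
    (by positivity)

theorem continuous_tremble (ε : ℝ) (h0 : 0 < ε) (h1 : ε ≤ 1) :
    Continuous (tremble (G := G) ε h0 h1) :=
  continuous_pi fun κ => Continuous.subtype_mk (continuous_pi fun x =>
    (continuous_const.mul (continuous_strategy_apply κ x)).add continuous_const) _

/-- The value of an action when the insider trembles and the market maker uses Bayes' rule. -/
def trembleValue (ε : ℝ) (h0 : 0 < ε) (h1 : ε ≤ 1) (σ : G.BehaviourStrategy) (κ : G.InsiderNode)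
    (x : G.EX) : ℝ :=
  actionValue (tremble ε h0 h1 σ)
    (pricing (bayesBeliefs _ (isCompletelyMixed_tremble ε h0 h1 σ))) κ.1 κ.2 x

theorem continuous_trembleValue (ε : ℝ) (h0 : 0 < ε) (h1 : ε ≤ 1) :
    Continuous (trembleValue (G := G) ε h0 h1) := by
  refine continuous_pi fun κ => continuous_pi fun x => ?_
  exact continuous_iff_continuousAt.2 fun σ => tendsto_actionValue
    ((continuous_tremble ε h0 h1).tendsto σ)
    ((continuous_bayesBeliefs (continuous_tremble ε h0 h1)
      (isCompletelyMixed_tremble ε h0 h1)).tendsto σ) κ.1 κ.2 x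

theorem exists_trembling_equilibrium (ε : ℝ) (h0 : 0 < ε) (h1 : ε ≤ 1) :
    ∃ σ : G.BehaviourStrategy, ∀ (κ : G.InsiderNode) (x : G.EX), 0 < σ κ x →
      ∀ x', trembleValue ε h0 h1 σ κ x' ≤ trembleValue ε h0 h1 σ κ x := by
  have hne : Nonempty G.EX := G.EX_nonempty.to_subtype
  exact exists_mixed_equilibrium (A := G.InsiderNode) (B := G.EX)
    (continuous_trembleValue ε h0 h1)

end KyleGame

/-! ### The limit of vanishing trembles -/

/-- Every Kyle game has a sequential Kyle equilibrium. -/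
theorem theorem2 (G : KyleGame) :
    ∃ (ξ : G.BehaviourStrategy) (μ : G.Beliefs), KyleGame.IsSequentialKyleEquilibrium ξ μ := by
  have h0 : ∀ n : ℕ, (0 : ℝ) < 1 / ((n : ℝ) + 1) := fun n => Nat.one_div_pos_of_nat
  have h1 : ∀ n : ℕ, 1 / ((n : ℝ) + 1) ≤ (1 : ℝ) := fun n => by
    rw [div_le_one (by positivity)]
    linarith [(Nat.cast_nonneg n : (0 : ℝ) ≤ n)]
  choose σ hσ using fun n : ℕ => KyleGame.exists_trembling_equilibrium (G := G) _ (h0 n) (h1 n)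
  let ξs : ℕ → G.BehaviourStrategy := fun n => KyleGame.tremble _ (h0 n) (h1 n) (σ n)
  have hmix : ∀ n, KyleGame.IsCompletelyMixed (ξs n) := fun n =>
    KyleGame.isCompletelyMixed_tremble _ (h0 n) (h1 n) (σ n)
  let μs : ℕ → G.Beliefs := fun n => KyleGame.bayesBeliefs (ξs n) (hmix n)
  obtain ⟨⟨ξ, μ⟩, φ, hφ, hlim⟩ :=
    CompactSpace.tendsto_subseq (fun n => ((σ n, μs n) : G.BehaviourStrategy × G.Beliefs))
  have hσlim : Tendsto (fun n => σ (φ n)) atTop (𝓝 ξ) := (continuous_fst.tendsto _).comp hlim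
  have hμlim : Tendsto (fun n => μs (φ n)) atTop (𝓝 μ) := (continuous_snd.tendsto _).comp hlim
  have hε : Tendsto (fun n => 1 / ((φ n : ℝ) + 1)) atTop (𝓝 0) :=
    tendsto_one_div_add_atTop_nhds_zero_nat.comp hφ.tendsto_atTop
  have hσx : ∀ κ x, Tendsto (fun n => σ (φ n) κ x) atTop (𝓝 (ξ κ x)) := fun κ x =>
    ((KyleGame.continuous_strategy_apply κ x).tendsto ξ).comp hσlim
  -- The intended strategies and their trembling versions have the same limit: optimality is known
  -- for the support of the former, complete mixing for the latter.
  have hξx : ∀ κ x, Tendsto (fun n => ξs (φ n) κ x) atTop (𝓝 (ξ κ x)) := fun κ x => by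
    have := ((tendsto_const_nhds (x := (1 : ℝ))).sub hε).mul (hσx κ x) |>.add
      (hε.div_const (Fintype.card G.EX : ℝ))
    simp only [sub_zero, one_mul, zero_div, add_zero] at this
    exact this
  have hξlim : Tendsto (fun n => ξs (φ n)) atTop (𝓝 ξ) :=
    tendsto_pi_nhds.2 fun κ => tendsto_subtype_rng.2 (tendsto_pi_nhds.2 (hξx κ))
  refine ⟨ξ, μ, KyleGame.isSubgameOptimal_of_actionValue_le fun t k x hx x' => ?_,
    fun n => ξs (φ n), fun n => μs (φ n), hξx, fun t y i =>
      ((KyleGame.continuous_beliefs_apply t y i).tendsto μ).comp hμlim, fun n => hmix _,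
    fun n => KyleGame.isRational_bayesBeliefs (hmix _)⟩
  refine le_of_tendsto_of_tendsto (KyleGame.tendsto_actionValue hξlim hμlim t k x')
    (KyleGame.tendsto_actionValue hξlim hμlim t k x) ?_
  -- A trade with positive limit weight is in the support of `σ (φ n)` for large `n`, hence optimal
  -- there.
  filter_upwards [(hσx ⟨t, k⟩ x).eventually (lt_mem_nhds hx)] with n hn
  exact hσ (φ n) ⟨t, k⟩ x hn x'

end
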